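/- Let $R_{12}$ be the double Riesz transform on $\mathbb{R}^2$ with kernel $K(x,y)=\frac{xy}{2\pi(x^2+y^2)^2}$, that is, for a Schwartz function $f:\mathbb{R}^2\to\mathbb{C}$ and $z\in\mathbb{R}^2$, $$R_{12}f(z)=\lim_{\varepsilon\to 0^+}\int_{|z-w|>\varepsilon}K(z-w)\,f(w)\,dw .$$ Then for every real number $p>2$ there is no finite constant $C_p$ such that $$\bigl\|\,\|R_{12}f(x,y)\|_{L^p_x(\mathbb{R})}\bigr\|_{L^\infty_y(\mathbb{R})}\le C_p\,\bigl\|\,\|f(x,y)\|_{L^\infty_y(\mathbb{R})}\bigr\|_{L^p_x(\mathbb{R})}$$ for all Schwartz functions $f:\mathbb{R}^2\to\mathbb{C}$. -/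

import Mathlib

open MeasureTheory Filter Topology
open scoped ENNReal NNReal SchwartzMap

/-- The truncated singular integral `∫_{|z - w| > ε} K(z - w) f(w) dw` on the plane, where `|·|` is
the Euclidean norm (the norm that `ℝ × ℝ` carries in Mathlib is the maximum norm). -/
noncomputable def truncatedSingularIntegral (K : ℝ × ℝ → ℂ) (f : 𝓢(ℝ × ℝ, ℂ)) (z : ℝ × ℝ)
    (ε : ℝ) : ℂ :=
  ∫ w in {w : ℝ × ℝ | ε < √((z.1 - w.1) ^ 2 + (z.2 - w.2) ^ 2)}, K (z - w) * f w

/-- The operator `Tf(z) = lim_{ε → 0+} ∫_{|z - w| > ε} K(z - w) f(w) dw` on Schwartz functions. -/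
noncomputable def singularIntegralOperator (K : ℝ × ℝ → ℂ) (f : 𝓢(ℝ × ℝ, ℂ)) (z : ℝ × ℝ) : ℂ :=
  limUnder (𝓝[>] (0 : ℝ)) (truncatedSingularIntegral K f z)

/-- The kernel `K(x, y) = xy / (2π (x² + y²)²)`. -/
noncomputable def doubleRieszKernel (u : ℝ × ℝ) : ℝ :=
  u.1 * u.2 / (2 * Real.pi * (u.1 ^ 2 + u.2 ^ 2) ^ 2)

/-- The double Riesz transform `R₁₂`. -/
noncomputable def doubleRieszTransform (f : 𝓢(ℝ × ℝ, ℂ)) : ℝ × ℝ → ℂ :=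
  singularIntegralOperator (fun u => (doubleRieszKernel u : ℂ)) f

/-- The mixed norm `‖ ‖F(x,y)‖_{L^p_x} ‖_{L^q_y}`: the norm in `x` is taken first. -/
noncomputable def mixedNormXY (p q : ℝ≥0∞) (F : ℝ × ℝ → ℂ) : ℝ≥0∞ :=
  eLpNorm (fun y : ℝ => eLpNorm (fun x : ℝ => F (x, y)) p volume) q volume

/-- The mixed norm `‖ ‖F(x,y)‖_{L^q_y} ‖_{L^p_x}`: the norm in `y` is taken first. -/
noncomputable def mixedNormYX (q p : ℝ≥0∞) (F : ℝ × ℝ → ℂ) : ℝ≥0∞ :=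
  eLpNorm (fun x : ℝ => eLpNorm (fun y : ℝ => F (x, y)) q volume) p volume

/-- The limit that defines `R₁₂ f (z)` exists for every Schwartz function `f` and every point `z`,
so `limUnder` never takes its default value there. -/
theorem tendsto_doubleRieszTransform (f : 𝓢(ℝ × ℝ, ℂ)) (z : ℝ × ℝ) :
    Tendsto (truncatedSingularIntegral (fun u => (doubleRieszKernel u : ℂ)) f z)
      (𝓝[>] (0 : ℝ)) (𝓝 (doubleRieszTransform f z)) := by
  refine tendsto_nhds_limUnder ?_
  obtain ⟨L, hL0, hL⟩ : ∃ L : ℝ, 0 ≤ L ∧ ∀ a b : ℝ × ℝ, ‖f a - f b‖ ≤ L * ‖a - b‖ := by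
    refine ⟨SchwartzMap.seminorm ℝ 0 1 f, apply_nonneg _ _, fun a b => ?_⟩
    refine Convex.norm_image_sub_le_of_norm_fderiv_le (𝕜 := ℝ) (s := Set.univ)
      (fun x _ => f.differentiableAt) (fun x _ => ?_) convex_univ (Set.mem_univ _) (Set.mem_univ _)
    have := SchwartzMap.norm_iteratedFDeriv_le_seminorm ℝ f 1 x
    rwa [← norm_iteratedFDeriv_one]
  set k : ℝ × ℝ → ℂ := fun u => (doubleRieszKernel u : ℂ) with hk
  have hkm : Measurable k := by
    unfold k doubleRieszKernel
    fun_prop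
  set r : ℝ × ℝ → ℝ × ℝ := Prod.map (fun x => -x) id with hr
  have hrm : MeasurePreserving r volume volume :=
    (Measure.measurePreserving_neg volume).prod (MeasurePreserving.id volume)
  have hre : MeasurableEmbedding r :=
    (((MeasurableEquiv.neg ℝ).prodCongr (MeasurableEquiv.refl ℝ)).measurableEmbedding)
  set F : ℝ × ℝ → ℂ := fun u => f (z - u) with hF
  have hFi : Integrable F := by
    simpa [F] using (f.integrable (μ := volume)).comp_sub_left z
  have hFri : Integrable (fun u => F (r u)) := hrm.integrable_comp_of_integrable hFi
  have hkr : ∀ u, k (r u) = - k u := by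
    intro u
    simp [k, r, doubleRieszKernel, neg_div]
  -- bound on the kernel
  have hkb : ∀ u : ℝ × ℝ, ∀ ε : ℝ, 0 < ε → ε < √(u.1 ^ 2 + u.2 ^ 2) → ‖k u‖ ≤ 1 / ε ^ 2 := by
    intro u ε hε hu
    have h1 : ε ^ 2 < u.1 ^ 2 + u.2 ^ 2 := by
      rwa [Real.lt_sqrt hε.le] at hu
    have hpos : 0 < u.1 ^ 2 + u.2 ^ 2 := lt_trans (by positivity) h1
    simp only [k, doubleRieszKernel, Complex.norm_real, Real.norm_eq_abs, abs_div]
    rw [abs_of_pos (a := 2 * Real.pi * _) (by positivity), div_le_div_iff₀ (by positivity)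
      (by positivity)]
    have h2 : |u.1 * u.2| ≤ u.1 ^ 2 + u.2 ^ 2 := by
      rw [abs_le]; constructor <;> nlinarith [sq_nonneg (u.1 + u.2), sq_nonneg (u.1 - u.2)]
    have hpi := Real.pi_gt_three
    calc |u.1 * u.2| * ε ^ 2 ≤ (u.1 ^ 2 + u.2 ^ 2) * (u.1 ^ 2 + u.2 ^ 2) := by gcongr
      _ ≤ 1 * (2 * Real.pi * (u.1 ^ 2 + u.2 ^ 2) ^ 2) := by nlinarith [sq_nonneg (u.1 ^ 2 + u.2 ^ 2)]
  set S : ℝ → Set (ℝ × ℝ) := fun ε => {u | ε < √(u.1 ^ 2 + u.2 ^ 2)} with hS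
  have hSm : ∀ ε, MeasurableSet (S ε) := fun ε => measurableSet_lt measurable_const (by fun_prop)
  have hrS : ∀ ε u, r u ∈ S ε ↔ u ∈ S ε := by
    intro ε u; simp [S, r]
  set D : ℝ × ℝ → ℂ := fun u => k u * (F u - F (r u)) with hD
  have hint : ∀ ε, 0 < ε → ∀ G : ℝ × ℝ → ℂ, Integrable G →
      Integrable ((S ε).indicator (fun u => k u * G u)) := by
    intro ε hε G hG
    refine (hG.norm.const_mul (1 / ε ^ 2)).mono'
      ((hkm.aestronglyMeasurable.mul hG.aestronglyMeasurable).indicator (hSm ε)) ?_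
    refine Eventually.of_forall fun u => ?_
    by_cases hu : u ∈ S ε
    · rw [Set.indicator_of_mem hu, norm_mul]
      gcongr
      exact hkb u ε hε hu
    · rw [Set.indicator_of_notMem hu, norm_zero]; positivity
  have key : ∀ ε, 0 < ε → truncatedSingularIntegral k f z ε =
      (1 / 2) * ∫ u, (S ε).indicator D u := by
    intro ε hε
    have e1 : truncatedSingularIntegral k f z ε =
        ∫ u, (S ε).indicator (fun u => k u * F u) u := by
      unfold truncatedSingularIntegral
      rw [← integral_indicator (measurableSet_lt measurable_const (by fun_prop)),
        ← integral_sub_left_eq_self _ volume z]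
      congr 1
      ext u
      simp [Set.indicator_apply, S, F]
    have e2 : ∫ u, (S ε).indicator (fun u => k u * F u) u =
        - ∫ u, (S ε).indicator (fun u => k u * F (r u)) u := by
      rw [← hrm.integral_comp hre, ← integral_neg]
      congr 1
      ext u
      by_cases hu : u ∈ S ε
      · rw [Set.indicator_of_mem hu, Set.indicator_of_mem ((hrS ε u).2 hu), hkr, neg_mul]
      · rw [Set.indicator_of_notMem hu, Set.indicator_of_notMem (fun h => hu ((hrS ε u).1 h)),
          neg_zero]
    have e3 : ∫ u, (S ε).indicator D u = (∫ u, (S ε).indicator (fun u => k u * F u) u) -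
        ∫ u, (S ε).indicator (fun u => k u * F (r u)) u := by
      rw [← integral_sub (hint ε hε _ hFi) (hint ε hε _ hFri)]
      congr 1
      ext u
      by_cases hu : u ∈ S ε
      · simp [hu, D, mul_sub]
      · simp [hu]
    rw [e3, e1]
    linear_combination (1 / 2) * e2
  -- an integrable majorant
  set φ : ℝ → ℝ := (Set.Icc (-1) 1).indicator (fun x => |x| ^ (-(1 / 2) : ℝ)) with hφ
  have hφi : Integrable φ := by
    rw [hφ, integrable_indicator_iff measurableSet_Icc]
    have h := (intervalIntegral.intervalIntegrable_rpow' (a := 0) (b := 1)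
      (r := -(1 / 2)) (by norm_num))
    have h1 : IntegrableOn (fun x : ℝ => |x| ^ (-(1 / 2) : ℝ)) (Set.Ioc 0 1) := by
      rw [intervalIntegrable_iff_integrableOn_Ioc_of_le zero_le_one] at h
      refine h.congr_fun (fun x hx => ?_) measurableSet_Ioc
      simp only
      rw [abs_of_pos hx.1]
    have h2 : IntegrableOn (fun x : ℝ => |x| ^ (-(1 / 2) : ℝ)) (Set.Icc 0 1) :=
      (integrableOn_Icc_iff_integrableOn_Ioc).2 h1
    have h3 : IntegrableOn (fun x : ℝ => |x| ^ (-(1 / 2) : ℝ)) (Set.Icc (-1) 0) := by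
      have := h2.comp_neg
      simpa using this
    rw [← Set.Icc_union_Icc_eq_Icc (b := (0 : ℝ)) (by norm_num) (by norm_num)]
    exact h3.union h2
  have hφ0 : ∀ x, 0 ≤ φ x := fun x => Set.indicator_nonneg (fun x _ => by positivity) x
  set B : ℝ × ℝ → ℝ := fun u => 2 * L * (φ u.1 * φ u.2) + (‖F u‖ + ‖F (r u)‖) with hB
  have hBi : Integrable B := ((hφi.mul_prod hφi).const_mul _).add (hFi.norm.add hFri.norm)
  have hDB : ∀ u, ‖D u‖ ≤ B u := by
    intro u
    have hDn : ‖D u‖ = ‖k u‖ * ‖F u - F (r u)‖ := norm_mul _ _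
    by_cases h0 : u.1 = 0 ∨ u.2 = 0
    · have : k u = 0 := by
        rcases h0 with h | h <;> simp [k, doubleRieszKernel, h]
      rw [hDn, this, norm_zero, zero_mul]
      have := hφ0 u.1
      have := hφ0 u.2
      positivity
    push Not at h0
    by_cases hu : u.1 ∈ Set.Icc (-1 : ℝ) 1 ∧ u.2 ∈ Set.Icc (-1 : ℝ) 1
    · have hd : ‖F u - F (r u)‖ ≤ L * (2 * |u.1|) := by
        refine (hL _ _).trans (le_of_eq ?_)
        congr 1
        have : z - u - (z - r u) = (-2 * u.1, 0) := by
          ext <;> simp [r]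
          ring
        rw [this, Prod.norm_def]
        simp
      have ha : 0 < |u.1| := abs_pos.2 h0.1
      have hb : 0 < |u.2| := abs_pos.2 h0.2
      have hφφ : φ u.1 * φ u.2 = (√(|u.1| * |u.2|))⁻¹ := by
        rw [hφ, Set.indicator_of_mem hu.1, Set.indicator_of_mem hu.2,
          ← Real.mul_rpow (abs_nonneg _) (abs_nonneg _), Real.rpow_neg (by positivity),
          Real.sqrt_eq_rpow]
      have hkn : ‖k u‖ * |u.1| ≤ (√(|u.1| * |u.2|))⁻¹ := by
        simp only [k, doubleRieszKernel, Complex.norm_real, Real.norm_eq_abs, abs_div]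
        rw [abs_mul u.1, ← sq_abs u.1, ← sq_abs u.2]
        generalize |u.1| = a at *
        generalize |u.2| = b at *
        rw [abs_of_pos (a := 2 * Real.pi * _) (by positivity), div_mul_eq_mul_div,
          ← one_div, div_le_div_iff₀ (by positivity) (by positivity)]
        have hpi := Real.pi_gt_three
        have hs : √(a * b) ≤ a + b := by
          rw [Real.sqrt_le_left (by positivity)]
          nlinarith
        have h2 : a * b * a * (a + b) ≤ (a ^ 2 + b ^ 2) ^ 2 * 2 := by
          nlinarith [sq_nonneg (a ^ 2 - b ^ 2), sq_nonneg (a - b), mul_pos ha hb,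
            mul_nonneg (mul_pos ha hb).le (sq_nonneg (a - b)), sq_nonneg (a*b), sq_nonneg (b ^ 2),
            sq_nonneg (a * (a - b))]
        calc a * b * a * √(a * b) ≤ a * b * a * (a + b) := by gcongr
          _ ≤ (a ^ 2 + b ^ 2) ^ 2 * 2 := h2
          _ ≤ 1 * (2 * Real.pi * (a ^ 2 + b ^ 2) ^ 2) := by nlinarith [sq_nonneg (a ^ 2 + b ^ 2)]
      rw [hDn]
      calc ‖k u‖ * ‖F u - F (r u)‖ ≤ ‖k u‖ * (L * (2 * |u.1|)) := by gcongr
        _ = 2 * L * (‖k u‖ * |u.1|) := by ring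
        _ ≤ 2 * L * (φ u.1 * φ u.2) := by rw [hφφ]; gcongr
        _ ≤ B u := by simp only [B]; linarith [norm_nonneg (F u), norm_nonneg (F (r u))]
    · have h1 : 1 < u.1 ^ 2 + u.2 ^ 2 := by
        by_contra hcon
        push Not at hcon
        refine hu ⟨abs_le.1 (abs_le_one_iff_mul_self_le_one.2 ?_),
          abs_le.1 (abs_le_one_iff_mul_self_le_one.2 ?_)⟩ <;> nlinarith [sq_nonneg u.1, sq_nonneg u.2]
      have hk1 : ‖k u‖ ≤ 1 := by
        simpa using hkb u 1 one_pos ((Real.lt_sqrt zero_le_one).2 (by simpa using h1))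
      rw [hDn]
      calc ‖k u‖ * ‖F u - F (r u)‖ ≤ 1 * (‖F u‖ + ‖F (r u)‖) := by
            gcongr; exact norm_sub_le _ _
        _ ≤ B u := by
          have := mul_nonneg (hφ0 u.1) (hφ0 u.2)
          have := mul_nonneg hL0 this
          simp only [B]; linarith
  have hDm : AEStronglyMeasurable D volume :=
    hkm.aestronglyMeasurable.mul (hFi.sub hFri).aestronglyMeasurable
  refine ⟨(1 / 2) * ∫ u, D u, ?_⟩
  have hlim : Tendsto (fun ε => ∫ u, (S ε).indicator D u) (𝓝[>] (0 : ℝ)) (𝓝 (∫ u, D u)) := by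
    refine tendsto_integral_filter_of_dominated_convergence B
      (Eventually.of_forall fun ε => hDm.indicator (hSm ε))
      (Eventually.of_forall fun ε => Eventually.of_forall fun u =>
        (norm_indicator_le_norm_self _ _).trans (hDB u)) hBi ?_
    refine Eventually.of_forall fun u => ?_
    by_cases hu : u.1 ^ 2 + u.2 ^ 2 = 0
    · have h1 : u.1 = 0 := by nlinarith [sq_nonneg u.1, sq_nonneg u.2]
      have h0 : D u = 0 := by simp [D, k, doubleRieszKernel, h1]
      refine tendsto_const_nhds.congr fun ε => ?_
      by_cases h : u ∈ S ε <;> simp [h, h0]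
    · have hp : 0 < √(u.1 ^ 2 + u.2 ^ 2) := Real.sqrt_pos.2 (by positivity)
      refine tendsto_const_nhds.congr' ?_
      filter_upwards [nhdsWithin_le_nhds (Iio_mem_nhds hp)] with ε hε
      exact (Set.indicator_of_mem (show u ∈ S ε from hε) D).symm
  refine (hlim.const_mul (1 / 2)).congr' ?_
  filter_upwards [self_mem_nhdsWithin] with ε hε
  exact (key ε hε).symm

/-! In polar coordinates about `z` the function `(sin 2θ / r) Δg(z - r e^{iθ})` is the divergence of
a field whose flux through the circle of radius `r` tends to `2π ∂₁∂₂g(z)` as `r → 0` and to `0` as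
`r → ∞`; hence `R₁₂ Δg = -½ ∂₁∂₂g`. Take `g` to be the sum of the wave packets
`l⁻² e^{ilx} G(x, ly)` over `N` dyadic frequencies `l`. The Laplacian of a packet is
`e^{ilx} (∂₂²G - G)(x, ly) + O(1/l)`. If `∂₂²G - G` has compact support and vanishes on the line
`y = 0`, its dyadic dilates sum to a bounded function, so `f = Δg` is bounded uniformly in `N`, and
supported in a fixed strip. If moreover `∂₂G = 1` near the origin, then
`R₁₂ f(x, y) = -(i/2) ∑ e^{ilx}` for `x` in the unit interval and `y` near `0`, and this exponential
sum has `L²` norm `√N`, hence `Lᵖ` norm at least `√N` for `p ≥ 2`. -/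

open scoped LineDeriv
open Set

/-- The partial derivative `∂₁` on Schwartz functions on the plane. -/
noncomputable def partialFst : 𝓢(ℝ × ℝ, ℂ) →L[ℂ] 𝓢(ℝ × ℝ, ℂ) :=
  LineDeriv.lineDerivOpCLM ℂ 𝓢(ℝ × ℝ, ℂ) ((1, 0) : ℝ × ℝ)

/-- The partial derivative `∂₂` on Schwartz functions on the plane. -/
noncomputable def partialSnd : 𝓢(ℝ × ℝ, ℂ) →L[ℂ] 𝓢(ℝ × ℝ, ℂ) :=
  LineDeriv.lineDerivOpCLM ℂ 𝓢(ℝ × ℝ, ℂ) ((0, 1) : ℝ × ℝ)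

/-- The Laplacian `∂₁² + ∂₂²` on Schwartz functions on the plane. -/
noncomputable def planeLaplacian : 𝓢(ℝ × ℝ, ℂ) →L[ℂ] 𝓢(ℝ × ℝ, ℂ) :=
  partialFst ∘L partialFst + partialSnd ∘L partialSnd

theorem planeLaplacian_apply (g : 𝓢(ℝ × ℝ, ℂ)) :
    planeLaplacian g = partialFst (partialFst g) + partialSnd (partialSnd g) := rfl

theorem fderiv_eq_partialFst_add_partialSnd (g : 𝓢(ℝ × ℝ, ℂ)) (w v : ℝ × ℝ) :
    fderiv ℝ g w v = v.1 * partialFst g w + v.2 * partialSnd g w := by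
  have hv : v = v.1 • ((1, 0) : ℝ × ℝ) + v.2 • ((0, 1) : ℝ × ℝ) := by simp
  conv_lhs => rw [hv]
  simp only [map_add, map_smul, Complex.real_smul, partialFst, partialSnd,
    LineDeriv.lineDerivOpCLM_apply, SchwartzMap.lineDerivOp_apply_eq_fderiv]

theorem partialSnd_partialFst (g : 𝓢(ℝ × ℝ, ℂ)) :
    partialSnd (partialFst g) = partialFst (partialSnd g) := by
  have hsymm (w : ℝ × ℝ) : IsSymmSndFDerivAt ℝ g w :=
    (g.smooth 2).contDiffAt.isSymmSndFDerivAt (by simp)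
  have hdiff : Differentiable ℝ (fderiv ℝ g) :=
    ((g.smooth 2).fderiv_right (m := 1) (by norm_num)).differentiable one_ne_zero
  have hsnd (u v w : ℝ × ℝ) : (∂_{u} (∂_{v} g)) w = fderiv ℝ (fderiv ℝ g) w u v := by
    rw [SchwartzMap.lineDerivOp_apply_eq_fderiv,
      funext (SchwartzMap.lineDerivOp_apply_eq_fderiv v g),
      fderiv_clm_apply (hdiff w) (differentiableAt_const v)]
    simp
  ext w
  simp only [partialSnd, partialFst, LineDeriv.lineDerivOpCLM_apply, hsnd]
  exact hsymm w _ _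

section PolarFlux

variable (g : 𝓢(ℝ × ℝ, ℂ)) (z : ℝ × ℝ)

/-- The radial component `(∂₁∂₂g - sin θ cos θ Δg)(z - r e^{iθ})` of the field whose divergence in
the coordinates `q = (r, θ)` is `(sin 2θ / r) Δg(z - r e^{iθ})`. -/
noncomputable def radialFlux (q : ℝ × ℝ) : ℂ :=
  partialFst (partialSnd g) (z - polarCoord.symm q) -
    ((Real.sin q.2 * Real.cos q.2 : ℝ) : ℂ) * planeLaplacian g (z - polarCoord.symm q)

/-- The angular component `-r⁻¹ (cos² θ ∂₁²g - sin² θ ∂₂²g)(z - r e^{iθ})` of the field whose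
divergence in the coordinates `q = (r, θ)` is `(sin 2θ / r) Δg(z - r e^{iθ})`. -/
noncomputable def angularFlux (q : ℝ × ℝ) : ℂ :=
  -((q.1⁻¹ : ℝ) : ℂ) *
    (((Real.cos q.2 ^ 2 : ℝ) : ℂ) * partialFst (partialFst g) (z - polarCoord.symm q) -
      ((Real.sin q.2 ^ 2 : ℝ) : ℂ) * partialSnd (partialSnd g) (z - polarCoord.symm q))

theorem hasFDerivAt_comp_sub_polarCoord_symm (q : ℝ × ℝ) :
    HasFDerivAt (fun q => g (z - polarCoord.symm q))
      ((fderiv ℝ g (z - polarCoord.symm q)).comp (-fderivPolarCoordSymm q)) q :=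
  g.differentiableAt.hasFDerivAt.comp q ((hasFDerivAt_polarCoord_symm q).const_sub z)

theorem hasDerivAt_comp_sub_polarCoord_symm_radial (r θ : ℝ) :
    HasDerivAt (fun s => g (z - polarCoord.symm (s, θ)))
      (-(Real.cos θ * partialFst g (z - polarCoord.symm (r, θ)) +
        Real.sin θ * partialSnd g (z - polarCoord.symm (r, θ)))) r := by
  have h := (hasFDerivAt_comp_sub_polarCoord_symm g z (r, θ)).comp_hasDerivAt r
    ((hasDerivAt_id r).prodMk (hasDerivAt_const r θ))
  refine h.congr_deriv ?_
  simp [fderiv_eq_partialFst_add_partialSnd, fderivPolarCoordSymm, add_comm]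

theorem hasDerivAt_comp_sub_polarCoord_symm_angular (r θ : ℝ) :
    HasDerivAt (fun s => g (z - polarCoord.symm (r, s)))
      (r * (Real.sin θ * partialFst g (z - polarCoord.symm (r, θ)) -
        Real.cos θ * partialSnd g (z - polarCoord.symm (r, θ)))) θ := by
  have h := (hasFDerivAt_comp_sub_polarCoord_symm g z (r, θ)).comp_hasDerivAt θ
    ((hasDerivAt_const θ r).prodMk (hasDerivAt_id θ))
  refine h.congr_deriv ?_
  simp only [polarCoord_symm_apply, fderivPolarCoordSymm, neg_mul,
    ContinuousLinearMap.comp_neg, neg_apply, ContinuousLinearMap.comp_apply,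
    LinearMap.coe_toContinuousLinearMap', Matrix.toLin_finTwoProd_apply, mul_zero, mul_one,
    zero_add, fderiv_eq_partialFst_add_partialSnd, Complex.ofReal_neg, Complex.ofReal_mul]
  ring

theorem differentiable_radialFlux : Differentiable ℝ (radialFlux g z) := by
  have hcomp (X : 𝓢(ℝ × ℝ, ℂ)) : Differentiable ℝ fun q => X (z - polarCoord.symm q) :=
    fun q => (hasFDerivAt_comp_sub_polarCoord_symm X z q).differentiableAt
  have hsincos : Differentiable ℝ fun q : ℝ × ℝ => Real.sin q.2 * Real.cos q.2 := by fun_prop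
  exact (hcomp _).sub ((Complex.ofRealCLM.differentiable.comp hsincos).mul (hcomp _))

theorem differentiableAt_angularFlux {q : ℝ × ℝ} (hq : q.1 ≠ 0) :
    DifferentiableAt ℝ (angularFlux g z) q := by
  have hcomp (X : 𝓢(ℝ × ℝ, ℂ)) : DifferentiableAt ℝ (fun q => X (z - polarCoord.symm q)) q :=
    (hasFDerivAt_comp_sub_polarCoord_symm X z q).differentiableAt
  have hofReal {u : ℝ × ℝ → ℝ} (hu : DifferentiableAt ℝ u q) :
      DifferentiableAt ℝ (fun q => (u q : ℂ)) q := Complex.ofRealCLM.differentiableAt.comp q hu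
  exact (hofReal (differentiableAt_fst.inv hq)).neg.mul
    (((hofReal (by fun_prop)).mul (hcomp _)).sub ((hofReal (by fun_prop)).mul (hcomp _)))

theorem fderiv_radialFlux_apply_fst (r θ : ℝ) :
    fderiv ℝ (radialFlux g z) (r, θ) (1, 0) =
      -(Real.cos θ * partialFst (partialFst (partialSnd g)) (z - polarCoord.symm (r, θ)) +
        Real.sin θ * partialSnd (partialFst (partialSnd g)) (z - polarCoord.symm (r, θ))) +
      ((Real.sin θ * Real.cos θ : ℝ) : ℂ) *
        (Real.cos θ * partialFst (planeLaplacian g) (z - polarCoord.symm (r, θ)) +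
          Real.sin θ * partialSnd (planeLaplacian g) (z - polarCoord.symm (r, θ))) := by
  have hline := (differentiable_radialFlux g z (r, θ)).hasFDerivAt.comp_hasDerivAt r
    ((hasDerivAt_id r).prodMk (hasDerivAt_const r θ))
  have hrad (X : 𝓢(ℝ × ℝ, ℂ)) := hasDerivAt_comp_sub_polarCoord_symm_radial X z r θ
  refine (hline.unique
    ((hrad _).sub ((hrad _).const_mul ((Real.sin θ * Real.cos θ : ℝ) : ℂ)))).trans ?_
  ring

theorem fderiv_angularFlux_apply_snd {r : ℝ} (hr : r ≠ 0) (θ : ℝ) :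
    fderiv ℝ (angularFlux g z) (r, θ) (0, 1) =
      ((2 * Real.sin θ * Real.cos θ / r : ℝ) : ℂ) *
        planeLaplacian g (z - polarCoord.symm (r, θ)) -
      Real.cos θ ^ 2 *
        (Real.sin θ * partialFst (partialFst (partialFst g)) (z - polarCoord.symm (r, θ)) -
          Real.cos θ * partialSnd (partialFst (partialFst g)) (z - polarCoord.symm (r, θ))) +
      Real.sin θ ^ 2 *
        (Real.sin θ * partialFst (partialSnd (partialSnd g)) (z - polarCoord.symm (r, θ)) -
          Real.cos θ * partialSnd (partialSnd (partialSnd g)) (z - polarCoord.symm (r, θ))) := by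
  have hline := (differentiableAt_angularFlux g z (q := (r, θ)) hr).hasFDerivAt.comp_hasDerivAt θ
    ((hasDerivAt_const θ r).prodMk (hasDerivAt_id θ))
  have hang (X : 𝓢(ℝ × ℝ, ℂ)) := hasDerivAt_comp_sub_polarCoord_symm_angular X z r θ
  refine (hline.unique
    (((((Real.hasDerivAt_cos θ).fun_pow 2).ofReal_comp.mul (hang _)).sub
      (((Real.hasDerivAt_sin θ).fun_pow 2).ofReal_comp.mul (hang _))).const_mul
        (-((r⁻¹ : ℝ) : ℂ)))).trans ?_
  have hr' : (r : ℂ) ≠ 0 := by exact_mod_cast hr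
  simp only [planeLaplacian_apply, add_apply]
  push_cast
  field_simp
  ring

theorem fderiv_radialFlux_add_fderiv_angularFlux {r : ℝ} (hr : r ≠ 0) (θ : ℝ) :
    fderiv ℝ (radialFlux g z) (r, θ) (1, 0) + fderiv ℝ (angularFlux g z) (r, θ) (0, 1) =
      ((2 * Real.sin θ * Real.cos θ / r : ℝ) : ℂ) *
        planeLaplacian g (z - polarCoord.symm (r, θ)) := by
  have hlapFst : partialFst (planeLaplacian g) =
      partialFst (partialFst (partialFst g)) + partialSnd (partialFst (partialSnd g)) := by
    rw [partialSnd_partialFst, planeLaplacian_apply, map_add]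
  have hlapSnd : partialSnd (planeLaplacian g) =
      partialFst (partialFst (partialSnd g)) + partialSnd (partialSnd (partialSnd g)) := by
    rw [← partialSnd_partialFst g, ← partialSnd_partialFst (partialFst g), planeLaplacian_apply,
      map_add]
  rw [fderiv_radialFlux_apply_fst, fderiv_angularFlux_apply_snd g z hr, hlapFst, hlapSnd,
    partialSnd_partialFst (partialFst g), partialSnd_partialFst g,
    ← partialSnd_partialFst (partialSnd g)]
  simp only [add_apply]
  push_cast
  linear_combination
    (Complex.cos θ * partialFst (partialFst (partialSnd g)) (z - polarCoord.symm (r, θ)) +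
      Complex.sin θ * partialSnd (partialFst (partialSnd g)) (z - polarCoord.symm (r, θ))) *
      Complex.sin_sq_add_cos_sq θ

end PolarFlux

theorem integrableOn_smul_comp_polarCoord_symm {E : Type*} [NormedAddCommGroup E]
    [NormedSpace ℝ E] {f : ℝ × ℝ → E} (hf : Integrable f) :
    IntegrableOn (fun q => q.1 • f (polarCoord.symm q)) polarCoord.target := by
  have himage := (integrableOn_image_iff_integrableOn_abs_det_fderiv_smul volume
    polarCoord.open_target.measurableSet
    (fun q _ => (hasFDerivAt_polarCoord_symm q).hasFDerivWithinAt)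
    polarCoord.symm.injOn f).1 hf.integrableOn
  refine himage.congr_fun (fun q hq => ?_) polarCoord.open_target.measurableSet
  simp only [det_fderivPolarCoordSymm, abs_of_pos (show 0 < q.1 from hq.1)]

theorem polarCoord_symm_sq_add_sq (q : ℝ × ℝ) :
    (polarCoord.symm q).1 ^ 2 + (polarCoord.symm q).2 ^ 2 = q.1 ^ 2 := by
  rw [polarCoord_symm_apply]
  linear_combination q.1 ^ 2 * Real.cos_sq_add_sin_sq q.2

theorem mul_doubleRieszKernel_polarCoord_symm (r θ : ℝ) :
    r * doubleRieszKernel (polarCoord.symm (r, θ)) =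
      1 / (4 * Real.pi) * (2 * Real.sin θ * Real.cos θ / r) := by
  rcases eq_or_ne r 0 with rfl | hr
  · simp
  · have := Real.pi_ne_zero
    simp only [doubleRieszKernel, polarCoord_symm_sq_add_sq]
    simp only [polarCoord_symm_apply]
    field_simp
    ring

section PolarIntegral

variable (f g : 𝓢(ℝ × ℝ, ℂ)) (z : ℝ × ℝ)

theorem continuous_comp_sub_polarCoord_symm :
    Continuous fun q => f (z - polarCoord.symm q) :=
  f.continuous.comp (continuous_const.sub continuous_polarCoord_symm)

theorem integrableOn_polar_doubleRieszKernel_mul {ε : ℝ} (hε : 0 < ε) :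
    IntegrableOn (fun q : ℝ × ℝ => ((2 * Real.sin q.2 * Real.cos q.2 / q.1 : ℝ) : ℂ) *
      f (z - polarCoord.symm q)) (Ioi ε ×ˢ Ioo (-Real.pi) Real.pi) := by
  have hpolar : IntegrableOn (fun q : ℝ × ℝ => q.1 • f (z - polarCoord.symm q))
      (Ioi ε ×ˢ Ioo (-Real.pi) Real.pi) :=
    (integrableOn_smul_comp_polarCoord_symm (f.integrable.comp_sub_left z)).mono_set
      (prod_mono (Ioi_subset_Ioi hε.le) subset_rfl)
  have hbound (q : ℝ × ℝ) (hq : q ∈ Ioi ε ×ˢ Ioo (-Real.pi) Real.pi) :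
      ‖((2 * Real.sin q.2 * Real.cos q.2 / q.1 ^ 2 : ℝ) : ℂ)‖ ≤ 1 / ε ^ 2 := by
    rw [Complex.norm_real, norm_div, ← Real.sin_two_mul, norm_pow, Real.norm_eq_abs,
      Real.norm_eq_abs, sq_abs]
    gcongr
    · exact Real.abs_sin_le_one _
    · exact hq.1.le
  refine IntegrableOn.congr_fun (hpolar.bdd_mul (c := 1 / ε ^ 2)
    (f := fun q : ℝ × ℝ => ((2 * Real.sin q.2 * Real.cos q.2 / q.1 ^ 2 : ℝ) : ℂ)) ?_ ?_) ?_
      (measurableSet_Ioi.prod measurableSet_Ioo)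
  · exact Measurable.aestronglyMeasurable (by fun_prop)
  · exact ae_restrict_of_forall_mem (measurableSet_Ioi.prod measurableSet_Ioo) hbound
  · intro q hq
    have : (q.1 : ℂ) ≠ 0 := by exact_mod_cast (hε.trans hq.1).ne'
    simp only [Complex.real_smul]
    push_cast
    field_simp

theorem truncatedSingularIntegral_eq_polar {ε : ℝ} (hε : 0 < ε) :
    truncatedSingularIntegral (fun u => (doubleRieszKernel u : ℂ)) f z ε =
      ((1 / (4 * Real.pi) : ℝ) : ℂ) * ∫ r in Ioi ε, ∫ θ in (-Real.pi)..Real.pi,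
        ((2 * Real.sin θ * Real.cos θ / r : ℝ) : ℂ) * f (z - polarCoord.symm (r, θ)) := by
  have hsub : Ioi ε ×ˢ Ioo (-Real.pi) Real.pi ⊆ polarCoord.target :=
    prod_mono (Ioi_subset_Ioi hε.le) subset_rfl
  have hdisc (q : ℝ × ℝ) (hq : 0 < q.1) :
      √((polarCoord.symm q).1 ^ 2 + (polarCoord.symm q).2 ^ 2) = q.1 := by
    rw [polarCoord_symm_sq_add_sq, Real.sqrt_sq hq.le]
  simp_rw [intervalIntegral.integral_of_le (neg_le_self Real.pi_pos.le),
    integral_Ioc_eq_integral_Ioo (x := -Real.pi)]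
  rw [← setIntegral_prod (fun q : ℝ × ℝ => ((2 * Real.sin q.2 * Real.cos q.2 / q.1 : ℝ) : ℂ) *
    f (z - polarCoord.symm q)) (integrableOn_polar_doubleRieszKernel_mul f z hε),
    ← integral_const_mul, truncatedSingularIntegral,
    ← integral_indicator (measurableSet_lt measurable_const (by fun_prop)),
    ← integral_sub_left_eq_self _ volume z, ← integral_comp_polarCoord_symm,
    setIntegral_eq_of_subset_of_forall_sdiff_eq_zero polarCoord.open_target.measurableSet hsub]
  · refine setIntegral_congr_fun (measurableSet_Ioi.prod measurableSet_Ioo) fun q hq => ?_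
    have hr : ε < q.1 := hq.1
    simp only [indicator, mem_ofPred_eq, Prod.fst_sub, Prod.snd_sub, sub_sub_cancel,
      hdisc q (hε.trans hr), if_pos hr, Complex.real_smul]
    rw [← mul_assoc, ← mul_assoc, ← Complex.ofReal_mul, ← Complex.ofReal_mul,
      mul_doubleRieszKernel_polarCoord_symm]
  · rintro q ⟨hq, hnot⟩
    have hr : ¬ ε < q.1 := fun hr => hnot ⟨hr, hq.2⟩
    simp only [indicator, mem_ofPred_eq, Prod.fst_sub, Prod.snd_sub, sub_sub_cancel,
      hdisc q hq.1, if_neg hr, smul_zero]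

theorem integral_annulus_polar_planeLaplacian {ε M : ℝ} (hε : 0 < ε) (hM : ε ≤ M) :
    ∫ r in ε..M, ∫ θ in (-Real.pi)..Real.pi, ((2 * Real.sin θ * Real.cos θ / r : ℝ) : ℂ) *
        planeLaplacian g (z - polarCoord.symm (r, θ)) =
      (∫ θ in (-Real.pi)..Real.pi, radialFlux g z (M, θ)) -
        ∫ θ in (-Real.pi)..Real.pi, radialFlux g z (ε, θ) := by
  have hpos (q : ℝ × ℝ) (hq : q ∈ uIcc ε M ×ˢ uIcc (-Real.pi) Real.pi) : q.1 ≠ 0 := by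
    rw [uIcc_of_le hM] at hq
    exact (hε.trans_le hq.1.1).ne'
  have hint : IntegrableOn (fun q => fderiv ℝ (radialFlux g z) q (1, 0) +
      fderiv ℝ (angularFlux g z) q (0, 1)) (uIcc ε M ×ˢ uIcc (-Real.pi) Real.pi) := by
    refine (ContinuousOn.congr (ContinuousOn.mul ?_
      (continuous_comp_sub_polarCoord_symm (planeLaplacian g) z).continuousOn) fun q hq =>
        fderiv_radialFlux_add_fderiv_angularFlux g z (hpos q hq) q.2).integrableOn_compact
          (isCompact_uIcc.prod isCompact_uIcc)
    exact Complex.continuous_ofReal.comp_continuousOn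
      (ContinuousOn.div (by fun_prop) (by fun_prop) hpos)
  have hdiv := integral2_divergence_prod_of_hasFDerivAt (radialFlux g z) (angularFlux g z)
    (fderiv ℝ (radialFlux g z)) (fderiv ℝ (angularFlux g z)) ε (-Real.pi) M Real.pi
    (differentiable_radialFlux g z).continuous.continuousOn
    (fun q hq => (differentiableAt_angularFlux g z (hpos q hq)).continuousAt.continuousWithinAt)
    (fun q _ => (differentiable_radialFlux g z q).hasFDerivAt)
    (fun q hq => (differentiableAt_angularFlux g z
      (hpos q (prod_mono Ioo_subset_Icc_self Ioo_subset_Icc_self hq))).hasFDerivAt) hint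
  have hperiodic (r : ℝ) : angularFlux g z (r, Real.pi) = angularFlux g z (r, -Real.pi) := by
    simp [angularFlux, polarCoord_symm_apply]
  simp only [hperiodic, sub_self, zero_add] at hdiv
  rw [← hdiv]
  refine intervalIntegral.integral_congr fun r hr => ?_
  refine intervalIntegral.integral_congr fun θ hθ => ?_
  exact (fderiv_radialFlux_add_fderiv_angularFlux g z (hpos (r, θ) ⟨hr, hθ⟩) θ).symm

theorem tendsto_sub_polarCoord_symm_cocompact (θ : ℝ) :
    Tendsto (fun r => z - polarCoord.symm (r, θ)) atTop (cocompact (ℝ × ℝ)) := by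
  refine tendsto_cocompact_of_tendsto_dist_comp_atTop z (tendsto_atTop_mono (fun r => ?_)
    (tendsto_id.atTop_div_const zero_lt_two))
  have hsq := polarCoord_symm_sq_add_sq (r, θ)
  rw [dist_comm, dist_self_sub_right, Prod.norm_def, id, le_max_iff]
  by_contra! h
  have hfst := sq_lt_sq' (abs_lt.1 h.1).1 (abs_lt.1 h.1).2
  have hsnd := sq_lt_sq' (abs_lt.1 h.2).1 (abs_lt.1 h.2).2
  simp only at hsq
  nlinarith

theorem norm_radialFlux_le (q : ℝ × ℝ) :
    ‖radialFlux g z q‖ ≤ SchwartzMap.seminorm ℝ 0 0 (partialFst (partialSnd g)) +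
      SchwartzMap.seminorm ℝ 0 0 (planeLaplacian g) := by
  have htrig : ‖((Real.sin q.2 * Real.cos q.2 : ℝ) : ℂ)‖ ≤ 1 := by
    rw [Complex.norm_real, norm_mul]
    exact mul_le_one₀ (Real.abs_sin_le_one _) (norm_nonneg _) (Real.abs_cos_le_one _)
  refine (norm_sub_le _ _).trans (add_le_add (SchwartzMap.norm_le_seminorm ℝ _ _) ?_)
  rw [norm_mul]
  exact (mul_le_of_le_one_left (norm_nonneg _) htrig).trans (SchwartzMap.norm_le_seminorm ℝ _ _)

theorem tendsto_integral_radialFlux_atTop :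
    Tendsto (fun r => ∫ θ in (-Real.pi)..Real.pi, radialFlux g z (r, θ)) atTop (𝓝 0) := by
  have hdecay (X : 𝓢(ℝ × ℝ, ℂ)) (θ : ℝ) :
      Tendsto (fun r => X (z - polarCoord.symm (r, θ))) atTop (𝓝 0) :=
    X.toZeroAtInfty.zero_at_infty'.comp (tendsto_sub_polarCoord_symm_cocompact z θ)
  have hflux (θ : ℝ) : Tendsto (fun r => radialFlux g z (r, θ)) atTop (𝓝 0) := by
    simpa [radialFlux] using (hdecay (partialFst (partialSnd g)) θ).sub
      ((hdecay (planeLaplacian g) θ).const_mul ((Real.sin θ * Real.cos θ : ℝ) : ℂ))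
  have hcont := (differentiable_radialFlux g z).continuous
  simpa using intervalIntegral.tendsto_integral_filter_of_dominated_convergence
    (μ := volume) (a := -Real.pi) (b := Real.pi) (f := fun _ => (0 : ℂ)) _
    (.of_forall fun r => (hcont.comp (.prodMk_right r)).aestronglyMeasurable)
    (.of_forall fun r => .of_forall fun θ _ => norm_radialFlux_le g z (r, θ))
    intervalIntegrable_const (.of_forall fun θ _ => hflux θ)

theorem tendsto_integral_radialFlux_nhdsGT_zero :
    Tendsto (fun r => ∫ θ in (-Real.pi)..Real.pi, radialFlux g z (r, θ)) (𝓝[>] 0)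
      (𝓝 (2 * Real.pi * partialFst (partialSnd g) z)) := by
  have hcont : Continuous fun r => ∫ θ in (-Real.pi)..Real.pi, radialFlux g z (r, θ) :=
    intervalIntegral.continuous_parametric_intervalIntegral_of_continuous'
      (f := fun r θ => radialFlux g z (r, θ)) (differentiable_radialFlux g z).continuous _ _
  have hsincos : ∫ θ in (-Real.pi)..Real.pi, ((Real.sin θ * Real.cos θ : ℝ) : ℂ) = 0 := by
    rw [intervalIntegral.integral_ofReal, integral_sin_mul_cos₁]
    simp
  have hcenter : ∫ θ in (-Real.pi)..Real.pi, radialFlux g z (0, θ) =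
      2 * Real.pi * partialFst (partialSnd g) z := by
    have hz : z - ((0 : ℝ), (0 : ℝ)) = z := sub_zero z
    simp only [radialFlux, polarCoord_symm_apply, zero_mul, hz]
    rw [intervalIntegral.integral_sub (by simp)
      (Continuous.intervalIntegrable (by fun_prop) _ _), intervalIntegral.integral_mul_const,
      hsincos, intervalIntegral.integral_const, Complex.real_smul]
    push_cast
    ring
  rw [← hcenter]
  exact (hcont.tendsto 0).mono_left nhdsWithin_le_nhds

theorem truncatedSingularIntegral_planeLaplacian {ε : ℝ} (hε : 0 < ε) :
    truncatedSingularIntegral (fun u => (doubleRieszKernel u : ℂ)) (planeLaplacian g) z ε =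
      -((1 / (4 * Real.pi) : ℝ) : ℂ) * ∫ θ in (-Real.pi)..Real.pi, radialFlux g z (ε, θ) := by
  have hint : IntegrableOn (fun r => ∫ θ in (-Real.pi)..Real.pi,
      ((2 * Real.sin θ * Real.cos θ / r : ℝ) : ℂ) *
        planeLaplacian g (z - polarCoord.symm (r, θ))) (Ioi ε) := by
    simp_rw [intervalIntegral.integral_of_le (neg_le_self Real.pi_pos.le),
      integral_Ioc_eq_integral_Ioo (x := -Real.pi)]
    have := integrableOn_polar_doubleRieszKernel_mul (planeLaplacian g) z hε
    rw [IntegrableOn, Measure.volume_eq_prod, ← Measure.prod_restrict] at this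
    exact this.integral_prod_left
  have hannuli := (intervalIntegral_tendsto_integral_Ioi ε hint tendsto_id).congr'
    ((eventually_ge_atTop ε).mono fun M hM =>
      integral_annulus_polar_planeLaplacian g z hε hM)
  rw [truncatedSingularIntegral_eq_polar _ z hε, tendsto_nhds_unique hannuli
    ((tendsto_integral_radialFlux_atTop g z).sub_const _)]
  ring

theorem doubleRieszTransform_planeLaplacian :
    doubleRieszTransform (planeLaplacian g) z = -(1 / 2) * partialFst (partialSnd g) z := by
  have hcircles := (tendsto_doubleRieszTransform (planeLaplacian g) z).congr' <| by
    filter_upwards [self_mem_nhdsWithin] with ε hε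
    exact truncatedSingularIntegral_planeLaplacian g z hε
  rw [tendsto_nhds_unique hcircles ((tendsto_integral_radialFlux_nhdsGT_zero g z).const_mul _)]
  have : (Real.pi : ℂ) ≠ 0 := by exact_mod_cast Real.pi_ne_zero
  push_cast
  field_simp
  ring

end PolarIntegral

theorem hasTemperateGrowth_cexp_mul_I :
    (fun x : ℝ => Complex.exp (x * Complex.I)).HasTemperateGrowth := by
  have hderiv (x : ℝ) : HasDerivAt (fun x : ℝ => Complex.exp (x * Complex.I))
      (Complex.exp (x * Complex.I) * Complex.I) x := by
    simpa using ((Complex.ofRealCLM.hasDerivAt (x := x)).mul_const Complex.I).cexp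
  have hiter (n : ℕ) : iteratedDeriv n (fun x : ℝ => Complex.exp (x * Complex.I)) =
      fun x : ℝ => Complex.exp (x * Complex.I) * Complex.I ^ n := by
    induction n with
    | zero => simp
    | succ n ih =>
      rw [iteratedDeriv_succ, ih]
      ext x
      rw [((hderiv x).mul_const _).deriv, mul_assoc, pow_succ']
  refine ⟨(Complex.ofRealCLM.contDiff.mul contDiff_const).cexp, fun n => ⟨0, 1, fun x => ?_⟩⟩
  rw [norm_iteratedFDeriv_eq_norm_iteratedDeriv, hiter]
  simp

theorem hasTemperateGrowth_cexp_mul_fst_mul_I (l : ℝ) :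
    (fun z : ℝ × ℝ => Complex.exp ((l * z.1 : ℝ) * Complex.I)).HasTemperateGrowth :=
  hasTemperateGrowth_cexp_mul_I.comp (l • ContinuousLinearMap.fst ℝ ℝ ℝ).hasTemperateGrowth

/-- The modulation `g ↦ e^{ilx} g(x, y)` of Schwartz functions on the plane. -/
noncomputable def modulateFst (l : ℝ) : 𝓢(ℝ × ℝ, ℂ) →L[ℂ] 𝓢(ℝ × ℝ, ℂ) :=
  SchwartzMap.smulLeftCLM ℂ fun z : ℝ × ℝ => Complex.exp ((l * z.1 : ℝ) * Complex.I)

/-- The dilation `g ↦ g(x, ly)` of Schwartz functions on the plane. -/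
noncomputable def dilateSnd (l : ℝˣ) : 𝓢(ℝ × ℝ, ℂ) →L[ℂ] 𝓢(ℝ × ℝ, ℂ) :=
  SchwartzMap.compCLMOfContinuousLinearEquiv ℂ
    ((ContinuousLinearEquiv.refl ℝ ℝ).prodCongr (ContinuousLinearEquiv.smulLeft l))

/-- The wave packet `l⁻² e^{ilx} G(x, ly)` of frequency `l` and profile `G`. -/
noncomputable def wavePacket (l : ℝˣ) (G : 𝓢(ℝ × ℝ, ℂ)) : 𝓢(ℝ × ℝ, ℂ) :=
  ((l : ℂ) ^ 2)⁻¹ • modulateFst l (dilateSnd l G)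

theorem modulateFst_apply (l : ℝ) (g : 𝓢(ℝ × ℝ, ℂ)) (z : ℝ × ℝ) :
    modulateFst l g z = Complex.exp ((l * z.1 : ℝ) * Complex.I) * g z :=
  SchwartzMap.smulLeftCLM_apply_apply (hasTemperateGrowth_cexp_mul_fst_mul_I l) g z

theorem dilateSnd_apply (l : ℝˣ) (g : 𝓢(ℝ × ℝ, ℂ)) (z : ℝ × ℝ) :
    dilateSnd l g z = g (z.1, l * z.2) := rfl

theorem lineDerivOp_modulateFst (l : ℝ) (g : 𝓢(ℝ × ℝ, ℂ)) (v : ℝ × ℝ) :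
    ∂_{v} (modulateFst l g) = modulateFst l (∂_{v} g + (v.1 * l * Complex.I : ℂ) • g) := by
  ext z
  have hexp : HasFDerivAt (fun z : ℝ × ℝ => Complex.exp ((l * z.1 : ℝ) * Complex.I)) _ z :=
    ((Complex.ofRealCLM.comp (l • .fst ℝ ℝ ℝ)).hasFDerivAt.mul_const Complex.I).cexp
  rw [SchwartzMap.lineDerivOp_apply_eq_fderiv, funext (modulateFst_apply l g),
    (hexp.fun_mul (SchwartzMap.hasFDerivAt g z)).fderiv, modulateFst_apply]
  simp only [Complex.ofReal_mul, ContinuousLinearMap.comp_smulₛₗ, Real.ringHom_apply, smul_apply,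
    ContinuousLinearMap.comp_apply, ContinuousLinearMap.coe_fst', Complex.ofRealCLM_apply,
    Complex.real_smul, add_apply, smul_eq_mul, SchwartzMap.lineDerivOp_apply_eq_fderiv]
  ring

theorem partialFst_modulateFst (l : ℝ) (g : 𝓢(ℝ × ℝ, ℂ)) :
    partialFst (modulateFst l g) = modulateFst l (partialFst g + (l * Complex.I) • g) := by
  simp [partialFst, lineDerivOp_modulateFst]

theorem partialSnd_modulateFst (l : ℝ) (g : 𝓢(ℝ × ℝ, ℂ)) :
    partialSnd (modulateFst l g) = modulateFst l (partialSnd g) := by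
  simp [partialSnd, lineDerivOp_modulateFst]

theorem partialFst_dilateSnd (l : ℝˣ) (g : 𝓢(ℝ × ℝ, ℂ)) :
    partialFst (dilateSnd l g) = dilateSnd l (partialFst g) := by
  simp [partialFst, dilateSnd, SchwartzMap.lineDerivOp_compCLMOfContinuousLinearEquiv]

theorem partialSnd_dilateSnd (l : ℝˣ) (g : 𝓢(ℝ × ℝ, ℂ)) :
    partialSnd (dilateSnd l g) = (l : ℂ) • dilateSnd l (partialSnd g) := by
  have hdir : (ContinuousLinearEquiv.refl ℝ ℝ).prodCongr (ContinuousLinearEquiv.smulLeft l)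
      ((0, 1) : ℝ × ℝ) = (l : ℝ) • ((0, 1) : ℝ × ℝ) := by
    simp [Units.smul_def]
  rw [partialSnd, LineDeriv.lineDerivOpCLM_apply, dilateSnd,
    SchwartzMap.lineDerivOp_compCLMOfContinuousLinearEquiv, hdir, LineDeriv.lineDerivOp_left_smul]
  ext z
  simp

theorem planeLaplacian_modulateFst (l : ℝ) (g : 𝓢(ℝ × ℝ, ℂ)) :
    planeLaplacian (modulateFst l g) =
      modulateFst l (planeLaplacian g + (2 * l * Complex.I) • partialFst g - (l : ℂ) ^ 2 • g) := by
  rw [planeLaplacian_apply, partialFst_modulateFst, partialFst_modulateFst,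
    partialSnd_modulateFst, partialSnd_modulateFst, planeLaplacian_apply]
  ext z
  simp only [map_add, map_smul, modulateFst_apply, add_apply, sub_apply, smul_apply, smul_eq_mul]
  linear_combination Complex.exp ((l * z.1 : ℝ) * Complex.I) * l ^ 2 * g z * Complex.I_sq

theorem planeLaplacian_dilateSnd (l : ℝˣ) (g : 𝓢(ℝ × ℝ, ℂ)) :
    planeLaplacian (dilateSnd l g) =
      dilateSnd l (partialFst (partialFst g) + (l : ℂ) ^ 2 • partialSnd (partialSnd g)) := by
  rw [planeLaplacian_apply, partialFst_dilateSnd, partialFst_dilateSnd, partialSnd_dilateSnd,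
    map_smul, partialSnd_dilateSnd, smul_smul, ← sq, map_add, map_smul]

theorem planeLaplacian_wavePacket_apply (l : ℝˣ) (G : 𝓢(ℝ × ℝ, ℂ)) (z : ℝ × ℝ) :
    planeLaplacian (wavePacket l G) z = Complex.exp ((l * z.1 : ℝ) * Complex.I) *
      ((partialSnd (partialSnd G) - G) (z.1, l * z.2) +
        2 * Complex.I / l * partialFst G (z.1, l * z.2) +
        (l : ℂ)⁻¹ ^ 2 * partialFst (partialFst G) (z.1, l * z.2)) := by
  have hl : (l : ℂ) ≠ 0 := by exact_mod_cast l.ne_zero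
  rw [wavePacket, map_smul, planeLaplacian_modulateFst, planeLaplacian_dilateSnd,
    partialFst_dilateSnd]
  simp only [modulateFst_apply, dilateSnd_apply, add_apply, sub_apply, smul_apply, smul_eq_mul]
  field_simp
  ring

theorem partialFst_partialSnd_wavePacket_apply (l : ℝˣ) (G : 𝓢(ℝ × ℝ, ℂ)) (z : ℝ × ℝ) :
    partialFst (partialSnd (wavePacket l G)) z = Complex.exp ((l * z.1 : ℝ) * Complex.I) *
      (Complex.I * partialSnd G (z.1, l * z.2) +
        (l : ℂ)⁻¹ * partialFst (partialSnd G) (z.1, l * z.2)) := by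
  have hl : (l : ℂ) ≠ 0 := by exact_mod_cast l.ne_zero
  rw [wavePacket, map_smul, map_smul, partialSnd_modulateFst, partialFst_modulateFst,
    partialSnd_dilateSnd, map_smul, partialFst_dilateSnd]
  simp only [modulateFst_apply, dilateSnd_apply, add_apply, smul_apply, smul_eq_mul]
  field_simp
  ring

theorem norm_sub_le_seminorm_mul_norm_sub {E F : Type*} [NormedAddCommGroup E] [NormedSpace ℝ E]
    [NormedAddCommGroup F] [NormedSpace ℝ F] (f : 𝓢(E, F)) (a b : E) :
    ‖f a - f b‖ ≤ SchwartzMap.seminorm ℝ 0 1 f * ‖a - b‖ := by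
  refine convex_univ.norm_image_sub_le_of_norm_fderiv_le (𝕜 := ℝ)
    (fun x _ => f.differentiableAt) (fun x _ => ?_) (mem_univ b) (mem_univ a)
  rw [← norm_iteratedFDeriv_one]
  exact SchwartzMap.norm_iteratedFDeriv_le_seminorm ℝ f 1 x

theorem sum_norm_dyadic_dilates_le {E : Type*} [SeminormedAddCommGroup E] {b : ℝ → E} {M R : ℝ}
    (hR : 0 ≤ R) (hb : ∀ t, ‖b t‖ ≤ M * |t|) (hb0 : ∀ t, R < |t| → b t = 0) (s : ℝ) (N : ℕ) :
    ∑ j ∈ Finset.range N, ‖b (2 ^ j * s)‖ ≤ 2 * M * R := by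
  have hM : 0 ≤ M := by simpa using (norm_nonneg _).trans (hb 1)
  have habs (j : ℕ) : |2 ^ j * s| = 2 ^ j * |s| := by rw [abs_mul, abs_of_pos (by positivity)]
  induction N with
  | zero =>
    rw [Finset.range_zero, Finset.sum_empty]
    positivity
  | succ N ih =>
    rcases lt_or_ge R |2 ^ N * s| with h | h
    · rwa [Finset.sum_range_succ, hb0 _ h, norm_zero, add_zero]
    · calc ∑ j ∈ Finset.range (N + 1), ‖b (2 ^ j * s)‖
          ≤ ∑ j ∈ Finset.range (N + 1), M * |s| * 2 ^ j :=
            Finset.sum_le_sum fun j _ => (hb _).trans_eq (by rw [habs]; ring)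
        _ = M * |s| * (2 ^ (N + 1) - 1) := by
            rw [← Finset.mul_sum, geom_sum_eq (by norm_num)]
            norm_num
        _ ≤ M * |s| * 2 ^ (N + 1) := by gcongr; linarith
        _ = 2 * M * |2 ^ N * s| := by rw [habs]; ring
        _ ≤ 2 * M * R := by gcongr

theorem norm_planeLaplacian_wavePacket_le {l : ℝˣ} (hl : 1 ≤ |(l : ℝ)|) (G : 𝓢(ℝ × ℝ, ℂ))
    (z : ℝ × ℝ) :
    ‖planeLaplacian (wavePacket l G) z‖ ≤
      ‖(partialSnd (partialSnd G) - G) (z.1, l * z.2)‖ +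
        (2 * SchwartzMap.seminorm ℝ 0 0 (partialFst G) +
          SchwartzMap.seminorm ℝ 0 0 (partialFst (partialFst G))) * |(l : ℝ)|⁻¹ := by
  have hinv : |(l : ℝ)|⁻¹ ^ 2 ≤ |(l : ℝ)|⁻¹ :=
    pow_le_of_le_one (by positivity) (inv_le_one_of_one_le₀ hl) two_ne_zero
  rw [planeLaplacian_wavePacket_apply, norm_mul, Complex.norm_exp_ofReal_mul_I, one_mul]
  refine norm_add₃_le.trans ?_
  rw [norm_mul, norm_mul, norm_div, norm_mul, norm_pow, norm_inv, Complex.norm_I,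
    Complex.norm_real, Real.norm_eq_abs, Complex.norm_ofNat, mul_one]
  calc _ ≤ ‖(partialSnd (partialSnd G) - G) (z.1, l * z.2)‖ +
        2 / |(l : ℝ)| * SchwartzMap.seminorm ℝ 0 0 (partialFst G) +
        |(l : ℝ)|⁻¹ * SchwartzMap.seminorm ℝ 0 0 (partialFst (partialFst G)) := by
        gcongr <;> exact SchwartzMap.norm_le_seminorm ℝ _ _
    _ = _ := by ring

theorem tsupport_partialFst_subset (g : 𝓢(ℝ × ℝ, ℂ)) : tsupport (partialFst g) ⊆ tsupport g :=
  SchwartzMap.tsupport_lineDerivOp_subset _ g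

theorem tsupport_partialSnd_subset (g : 𝓢(ℝ × ℝ, ℂ)) : tsupport (partialSnd g) ⊆ tsupport g :=
  SchwartzMap.tsupport_lineDerivOp_subset _ g

theorem planeLaplacian_wavePacket_eq_zero {l : ℝˣ} {G : 𝓢(ℝ × ℝ, ℂ)} {z : ℝ × ℝ}
    (hz : (z.1, l * z.2) ∉ tsupport G) : planeLaplacian (wavePacket l G) z = 0 := by
  have hfst : (z.1, l * z.2) ∉ tsupport (partialFst G) :=
    fun h => hz (tsupport_partialFst_subset G h)
  have hsnd : (z.1, l * z.2) ∉ tsupport (partialSnd G) :=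
    fun h => hz (tsupport_partialSnd_subset G h)
  rw [planeLaplacian_wavePacket_apply, sub_apply, image_eq_zero_of_notMem_tsupport hz,
    image_eq_zero_of_notMem_tsupport hfst,
    image_eq_zero_of_notMem_tsupport fun h => hfst (tsupport_partialFst_subset _ h),
    image_eq_zero_of_notMem_tsupport fun h => hsnd (tsupport_partialSnd_subset _ h)]
  simp

/-- The frequency `2π 2ʲ`. -/
noncomputable def dyadicFrequency (j : ℕ) : ℝˣ := Units.mk0 (2 * Real.pi * 2 ^ j) (by positivity)

theorem two_pow_le_abs_dyadicFrequency (j : ℕ) : 2 ^ j ≤ |(dyadicFrequency j : ℝ)| := by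
  refine (le_mul_of_one_le_left (by positivity) ?_).trans (le_abs_self _)
  linarith [Real.pi_gt_three]

/-- The sum of the wave packets with profile `G` at the first `N` dyadic frequencies. -/
noncomputable def lacunaryPacket (N : ℕ) (G : 𝓢(ℝ × ℝ, ℂ)) : 𝓢(ℝ × ℝ, ℂ) :=
  ∑ j ∈ Finset.range N, wavePacket (dyadicFrequency j) G

theorem exists_norm_planeLaplacian_lacunaryPacket_le {G : 𝓢(ℝ × ℝ, ℂ)}
    (hsupp : HasCompactSupport G)
    (hG : ∀ x, partialSnd (partialSnd G) (x, 0) = G (x, 0)) :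
    ∃ D : ℝ, ∀ N z, ‖planeLaplacian (lacunaryPacket N G) z‖ ≤ D := by
  obtain ⟨R, hR, hGR⟩ := hsupp.isCompact.isBounded.subset_closedBall_lt 0 0
  set b := partialSnd (partialSnd G) - G with hb
  set K := 2 * SchwartzMap.seminorm ℝ 0 0 (partialFst G) +
    SchwartzMap.seminorm ℝ 0 0 (partialFst (partialFst G))
  have : 0 ≤ K := by positivity
  have hlip (x t : ℝ) : ‖b (x, t)‖ ≤ SchwartzMap.seminorm ℝ 0 1 b * |t| := by
    simpa [hb, hG] using norm_sub_le_seminorm_mul_norm_sub b (x, t) (x, 0)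
  have hzero (x t : ℝ) (ht : R < |t|) : b (x, t) = 0 := by
    have hG : (x, t) ∉ tsupport G := fun h => absurd ((le_max_right _ _).trans
      (mem_closedBall_zero_iff.1 (hGR h))) (not_le.2 ht)
    rw [hb, sub_apply, image_eq_zero_of_notMem_tsupport hG, image_eq_zero_of_notMem_tsupport
      fun h => hG (tsupport_partialSnd_subset _ (tsupport_partialSnd_subset _ h)), sub_zero]
  refine ⟨2 * SchwartzMap.seminorm ℝ 0 1 b * R + K * 2, fun N z => ?_⟩
  rw [lacunaryPacket, map_sum, sum_apply]
  calc ‖∑ j ∈ Finset.range N, planeLaplacian (wavePacket (dyadicFrequency j) G) z‖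
      ≤ ∑ j ∈ Finset.range N, (‖b (z.1, 2 ^ j * (2 * Real.pi * z.2))‖ + K * (1 / 2) ^ j) := by
        refine norm_sum_le_of_le _ fun j _ => ?_
        have hfreq := two_pow_le_abs_dyadicFrequency j
        have harg : dyadicFrequency j * z.2 = 2 ^ j * (2 * Real.pi * z.2) := by
          rw [dyadicFrequency, Units.val_mk0]
          ring
        refine (norm_planeLaplacian_wavePacket_le
          ((one_le_pow₀ one_le_two).trans hfreq) G z).trans ?_
        rw [harg, one_div_pow, one_div]
        gcongr
    _ = (∑ j ∈ Finset.range N, ‖b (z.1, 2 ^ j * (2 * Real.pi * z.2))‖) +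
          K * ∑ j ∈ Finset.range N, (1 / 2) ^ j := by
        rw [Finset.sum_add_distrib, Finset.mul_sum]
    _ ≤ 2 * SchwartzMap.seminorm ℝ 0 1 b * R + K * 2 := by
        gcongr
        · exact sum_norm_dyadic_dilates_le (b := fun t => b (z.1, t)) hR.le (hlip z.1)
            (hzero z.1) _ N
        · exact sum_geometric_two_le N

theorem planeLaplacian_lacunaryPacket_eq_zero {G : 𝓢(ℝ × ℝ, ℂ)} {R : ℝ}
    (hG : tsupport G ⊆ Metric.closedBall 0 R) (N : ℕ) {z : ℝ × ℝ} (hz : R < |z.1|) :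
    planeLaplacian (lacunaryPacket N G) z = 0 := by
  rw [lacunaryPacket, map_sum, sum_apply]
  refine Finset.sum_eq_zero fun j _ => planeLaplacian_wavePacket_eq_zero fun h => ?_
  exact ((le_max_left _ _).trans (mem_closedBall_zero_iff.1 (hG h))).not_gt hz

theorem partialFst_apply_eq_deriv (g : 𝓢(ℝ × ℝ, ℂ)) (x y : ℝ) :
    partialFst g (x, y) = deriv (fun s => g (s, y)) x := by
  have hslice := (SchwartzMap.hasFDerivAt g (x, y)).comp_hasDerivAt x
    ((hasDerivAt_id x).prodMk (hasDerivAt_const x y))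
  exact (SchwartzMap.lineDerivOp_apply_eq_fderiv _ g _).trans hslice.deriv.symm

theorem partialSnd_apply_eq_deriv (g : 𝓢(ℝ × ℝ, ℂ)) (x y : ℝ) :
    partialSnd g (x, y) = deriv (fun t => g (x, t)) y := by
  have hslice := (SchwartzMap.hasFDerivAt g (x, y)).comp_hasDerivAt y
    ((hasDerivAt_const y x).prodMk (hasDerivAt_id y))
  exact (SchwartzMap.lineDerivOp_apply_eq_fderiv _ g _).trans hslice.deriv.symm

/-- A smooth cutoff, equal to `1` on `[-2, 2]` and supported in `[-3, 3]`. -/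
noncomputable def cutoff : ContDiffBump (0 : ℝ) := ⟨2, 3, two_pos, by norm_num⟩

theorem cutoff_eventually_eq_one {x : ℝ} (hx : |x| < 2) : ∀ᶠ s in 𝓝 x, cutoff s = 1 := by
  filter_upwards [Metric.isOpen_ball.mem_nhds (mem_ball_zero_iff.2 hx)] with s hs
  exact cutoff.one_of_mem_closedBall (Metric.ball_subset_closedBall hs)

theorem cutoff_eq_zero {x : ℝ} (hx : x ∉ Metric.closedBall 0 3) : cutoff x = 0 :=
  cutoff.zero_of_le_dist (not_le.1 hx).le

theorem snd_mul_cutoff_mul_cutoff_eq_zero {z : ℝ × ℝ} (hz : z ∉ Metric.closedBall 0 3) :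
    ((z.2 * cutoff z.1 * cutoff z.2 : ℝ) : ℂ) = 0 := by
  rw [← Prod.mk_zero_zero, ← closedBall_prod_same] at hz
  rcases not_and_or.1 hz with h | h <;> simp [cutoff_eq_zero h]

theorem hasCompactSupport_snd_mul_cutoff_mul_cutoff :
    HasCompactSupport fun z : ℝ × ℝ => ((z.2 * cutoff z.1 * cutoff z.2 : ℝ) : ℂ) :=
  .intro (isCompact_closedBall 0 3) fun _ => snd_mul_cutoff_mul_cutoff_eq_zero

theorem contDiff_snd_mul_cutoff_mul_cutoff {n : ℕ∞} :
    ContDiff ℝ n fun z : ℝ × ℝ => ((z.2 * cutoff z.1 * cutoff z.2 : ℝ) : ℂ) :=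
  Complex.ofRealCLM.contDiff.comp
    ((contDiff_snd.mul (cutoff.contDiff.comp contDiff_fst)).mul (cutoff.contDiff.comp contDiff_snd))

/-- The compactly supported profile `y χ(x) χ(y)` with `χ` the `cutoff`, whose derivative in `y`
is `1` near the origin. -/
noncomputable def packetProfile : 𝓢(ℝ × ℝ, ℂ) :=
  hasCompactSupport_snd_mul_cutoff_mul_cutoff.toSchwartzMap contDiff_snd_mul_cutoff_mul_cutoff

theorem tsupport_packetProfile_subset : tsupport packetProfile ⊆ Metric.closedBall 0 3 :=
  closure_minimal (fun _ hz => not_not.1 fun h => hz (snd_mul_cutoff_mul_cutoff_eq_zero h))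
    Metric.isClosed_closedBall

theorem partialSnd_packetProfile (x : ℝ) {y : ℝ} (hy : |y| < 2) :
    partialSnd packetProfile (x, y) = (cutoff x : ℂ) := by
  have hlinear : (fun t => packetProfile (x, t)) =ᶠ[𝓝 y] fun t : ℝ => (t : ℂ) * cutoff x := by
    filter_upwards [cutoff_eventually_eq_one hy] with t ht
    change ((t * cutoff x * cutoff t : ℝ) : ℂ) = _
    simp [ht]
  rw [partialSnd_apply_eq_deriv, hlinear.deriv_eq]
  simpa using (Complex.ofRealCLM.hasDerivAt.mul_const (cutoff x : ℂ)).deriv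

theorem partialSnd_partialSnd_packetProfile (x : ℝ) {y : ℝ} (hy : |y| < 2) :
    partialSnd (partialSnd packetProfile) (x, y) = 0 := by
  have hconst : (fun t => partialSnd packetProfile (x, t)) =ᶠ[𝓝 y] fun _ => (cutoff x : ℂ) := by
    filter_upwards [(isOpen_lt continuous_abs continuous_const).mem_nhds hy] with t ht
    exact partialSnd_packetProfile x ht
  rw [partialSnd_apply_eq_deriv, hconst.deriv_eq, deriv_const]

theorem partialFst_partialSnd_packetProfile {x y : ℝ} (hx : |x| < 2) (hy : |y| < 2) :
    partialFst (partialSnd packetProfile) (x, y) = 0 := by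
  have hconst : (fun s => partialSnd packetProfile (s, y)) =ᶠ[𝓝 x] fun _ => 1 := by
    filter_upwards [cutoff_eventually_eq_one hx] with s hs
    rw [partialSnd_packetProfile s hy, hs, Complex.ofReal_one]
  rw [partialFst_apply_eq_deriv, hconst.deriv_eq, deriv_const]

theorem packetProfile_fst_zero (x : ℝ) : packetProfile (x, 0) = 0 := by
  change ((0 * cutoff x * cutoff 0 : ℝ) : ℂ) = 0
  simp

theorem partialFst_partialSnd_wavePacket_packetProfile {l : ℝˣ} {z : ℝ × ℝ} (hx : |z.1| < 2)
    (hy : |l * z.2| < 2) :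
    partialFst (partialSnd (wavePacket l packetProfile)) z =
      Complex.I * Complex.exp ((l * z.1 : ℝ) * Complex.I) := by
  rw [partialFst_partialSnd_wavePacket_apply, partialFst_partialSnd_packetProfile hx hy,
    partialSnd_packetProfile _ hy, (cutoff_eventually_eq_one hx).self_of_nhds]
  push_cast
  ring

theorem doubleRieszTransform_lacunaryPacket {N : ℕ} {z : ℝ × ℝ} (hx : |z.1| < 2)
    (hy : ∀ j < N, |dyadicFrequency j * z.2| < 2) :
    doubleRieszTransform (planeLaplacian (lacunaryPacket N packetProfile)) z = -(Complex.I / 2) *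
      ∑ j ∈ Finset.range N, Complex.exp ((dyadicFrequency j * z.1 : ℝ) * Complex.I) := by
  rw [doubleRieszTransform_planeLaplacian, lacunaryPacket, map_sum, map_sum, sum_apply,
    Finset.sum_congr rfl fun j hj =>
      partialFst_partialSnd_wavePacket_packetProfile hx (hy j (Finset.mem_range.1 hj)),
    ← Finset.mul_sum]
  ring

theorem norm_sum_orthonormal {ι E : Type*} [NormedAddCommGroup E] [InnerProductSpace ℂ E]
    {v : ι → E} (hv : Orthonormal ℂ v) (s : Finset ι) : ‖∑ i ∈ s, v i‖ = √s.card := by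
  have h := hv.inner_sum 1 1 s
  simp only [Pi.one_apply, one_smul, map_one, mul_one, Finset.sum_const, nsmul_eq_mul] at h
  rw [norm_eq_sqrt_re_inner (𝕜 := ℂ), h]
  simp

theorem eLpNorm_two_sum_fourier {T : ℝ} [Fact (0 < T)] (s : Finset ℤ) :
    eLpNorm (∑ n ∈ s, fourier n : C(AddCircle T, ℂ)) 2 AddCircle.haarAddCircle =
      ENNReal.ofReal √s.card := by
  rw [← norm_sum_orthonormal (orthonormal_fourier (T := T)) s, ofReal_norm, Lp.enorm_def]
  simp only [fourierLp, ← map_sum]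
  exact eLpNorm_congr_ae (ContinuousMap.coeFn_toLp _ _).symm

theorem sqrt_card_le_eLpNorm_sum_fourier {p : ℝ≥0∞} (hp : 2 ≤ p) (s : Finset ℤ) :
    ENNReal.ofReal √s.card ≤ eLpNorm (fun x : ℝ => ∑ n ∈ s, fourier n (x : UnitAddCircle)) p
      (volume.restrict (Ioc 0 1)) := by
  have hmk : MeasurePreserving (fun x : ℝ => (x : UnitAddCircle)) (volume.restrict (Ioc 0 1))
      AddCircle.haarAddCircle := by
    simpa [AddCircle.volume_eq_smul_haarAddCircle] using UnitAddCircle.measurePreserving_mk 0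
  have hmeas := (∑ n ∈ s, fourier n : C(UnitAddCircle, ℂ)).continuous.aestronglyMeasurable
    (μ := AddCircle.haarAddCircle)
  calc ENNReal.ofReal √s.card
      = eLpNorm (∑ n ∈ s, fourier n : C(UnitAddCircle, ℂ)) 2 AddCircle.haarAddCircle :=
        (eLpNorm_two_sum_fourier s).symm
    _ ≤ eLpNorm (∑ n ∈ s, fourier n : C(UnitAddCircle, ℂ)) p AddCircle.haarAddCircle :=
        eLpNorm_le_eLpNorm_of_exponent_le hp hmeas
    _ = eLpNorm (fun x : ℝ => ∑ n ∈ s, fourier n (x : UnitAddCircle)) p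
          (volume.restrict (Ioc 0 1)) := by
        rw [← eLpNorm_comp_measurePreserving hmeas hmk]
        simp only [Function.comp_def, ContinuousMap.sum_apply]

theorem cexp_dyadicFrequency_mul_I (j : ℕ) (x : ℝ) :
    Complex.exp ((dyadicFrequency j * x : ℝ) * Complex.I) =
      fourier (2 ^ j) (x : UnitAddCircle) := by
  rw [fourier_coe_apply, dyadicFrequency, Units.val_mk0]
  congr 1
  push_cast
  ring

theorem sqrt_le_eLpNorm_sum_cexp_dyadicFrequency {p : ℝ≥0∞} (hp : 2 ≤ p) (N : ℕ) :
    ENNReal.ofReal √N ≤ eLpNorm (fun x : ℝ => ∑ j ∈ Finset.range N,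
      Complex.exp ((dyadicFrequency j * x : ℝ) * Complex.I)) p (volume.restrict (Ioc 0 1)) := by
  have hinj : Function.Injective fun j : ℕ => (2 : ℤ) ^ j :=
    pow_right_injective₀ two_pos (by norm_num)
  simpa only [cexp_dyadicFrequency_mul_I, Finset.card_map, Finset.card_range, Finset.sum_map,
    Function.Embedding.coeFn_mk] using
    sqrt_card_le_eLpNorm_sum_fourier hp ((Finset.range N).map ⟨_, hinj⟩)

theorem mixedNormYX_top_le_of_bound {F : ℝ × ℝ → ℂ} {C R : ℝ} (p : ℝ≥0∞)
    (hF : ∀ z, ‖F z‖ ≤ C) (hF0 : ∀ z : ℝ × ℝ, R < |z.1| → F z = 0) :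
    mixedNormYX ∞ p F ≤ eLpNorm ((Icc (-R) R).indicator fun _ : ℝ => C) p volume := by
  refine eLpNorm_mono_enorm fun x => ?_
  rw [enorm_eq_self, eLpNorm_exponent_top]
  refine eLpNormEssSup_le_of_ae_enorm_bound (.of_forall fun y => ?_)
  by_cases hx : x ∈ Icc (-R) R
  · rw [indicator_of_mem hx, enorm_le_iff_norm_le]
    exact (hF (x, y)).trans (le_abs_self C)
  · rw [hF0 (x, y) (not_le.1 fun h => hx (abs_le.1 h)), enorm_zero]
    exact zero_le

theorem le_mixedNormXY_top {F : ℝ × ℝ → ℂ} {p c : ℝ≥0∞} {y₀ : ℝ}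
    (h : ∀ᶠ y in 𝓝 y₀, c ≤ eLpNorm (fun x => F (x, y)) p volume) :
    c ≤ mixedNormXY p ∞ F := by
  rw [mixedNormXY, eLpNorm_exponent_top]
  by_contra! hlt
  have hae : ∀ᵐ y, eLpNorm (fun x => F (x, y)) p volume < c := ae_lt_of_essSup_lt hlt
  refine (Measure.measure_pos_of_mem_nhds volume h).ne' (measure_mono_null (fun y hy => ?_) hae)
  exact not_lt.2 (show c ≤ _ from hy)

theorem eventually_abs_dyadicFrequency_mul_lt (N : ℕ) :
    ∀ᶠ y in 𝓝 (0 : ℝ), ∀ j < N, |(dyadicFrequency j * y : ℝ)| < 2 := by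
  simp only [← Finset.mem_range, Finset.eventually_all]
  intro j _
  have hcont : Continuous fun y => |(dyadicFrequency j * y : ℝ)| := by fun_prop
  exact hcont.tendsto' 0 0 (by simp) |>.eventually_lt_const two_pos

theorem sqrt_div_two_le_mixedNormXY_lacunaryPacket {p : ℝ≥0∞} (hp : 2 ≤ p) (N : ℕ) :
    ENNReal.ofReal (√N / 2) ≤ mixedNormXY p ∞
      (doubleRieszTransform (planeLaplacian (lacunaryPacket N packetProfile))) := by
  refine le_mixedNormXY_top ((eventually_abs_dyadicFrequency_mul_lt N).mono fun y hy => ?_)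
  have hhalf : ‖-(Complex.I / 2)‖ₑ = ENNReal.ofReal (1 / 2) := by
    rw [← ofReal_norm]
    simp
  calc ENNReal.ofReal (√N / 2)
      = ENNReal.ofReal (1 / 2) * ENNReal.ofReal √N := by
        rw [← ENNReal.ofReal_mul (by norm_num), one_div_mul_eq_div]
    _ ≤ ‖-(Complex.I / 2)‖ₑ * eLpNorm (fun x : ℝ => ∑ j ∈ Finset.range N,
          Complex.exp ((dyadicFrequency j * x : ℝ) * Complex.I)) p
            (volume.restrict (Ioc 0 1)) := by
        rw [hhalf]
        gcongr
        exact sqrt_le_eLpNorm_sum_cexp_dyadicFrequency hp N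
    _ = eLpNorm (fun x => doubleRieszTransform
          (planeLaplacian (lacunaryPacket N packetProfile)) (x, y)) p
            (volume.restrict (Ioc 0 1)) := by
        rw [← eLpNorm_const_smul]
        refine eLpNorm_congr_ae (ae_restrict_of_forall_mem measurableSet_Ioc fun x hx => ?_)
        have hx2 : |x| < 2 := by rw [abs_of_pos hx.1]; linarith [hx.2]
        exact (doubleRieszTransform_lacunaryPacket (z := (x, y)) hx2 hy).symm
    _ ≤ _ := eLpNorm_mono_measure _ Measure.restrict_le_self

theorem exists_mixedNormYX_lacunaryPacket_le (p : ℝ≥0∞) :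
    ∃ E : ℝ≥0, ∀ N, mixedNormYX ∞ p (planeLaplacian (lacunaryPacket N packetProfile)) ≤ E := by
  obtain ⟨D, hD⟩ := exists_norm_planeLaplacian_lacunaryPacket_le (G := packetProfile)
    hasCompactSupport_snd_mul_cutoff_mul_cutoff fun x => by
      rw [partialSnd_partialSnd_packetProfile x (by simp), packetProfile_fst_zero]
  have hfin := (memLp_indicator_const (μ := volume) p (measurableSet_Icc (a := (-3 : ℝ)) (b := 3)) D
    (Or.inr measure_Icc_lt_top.ne)).eLpNorm_ne_top
  refine ⟨(eLpNorm ((Icc (-3 : ℝ) 3).indicator fun _ => D) p volume).toNNReal, fun N => ?_⟩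
  rw [ENNReal.coe_toNNReal hfin]
  exact mixedNormYX_top_le_of_bound p (hD N) fun z =>
    planeLaplacian_lacunaryPacket_eq_zero tsupport_packetProfile_subset N

theorem theorem2p5_general (p : ℝ≥0∞) (hp : 2 ≤ p) :
    ¬ ∃ C : ℝ≥0, ∀ f : 𝓢(ℝ × ℝ, ℂ),
      mixedNormXY p ∞ (doubleRieszTransform f) ≤ C * mixedNormYX ∞ p f := by
  rintro ⟨C, hC⟩
  obtain ⟨E, hE⟩ := exists_mixedNormYX_lacunaryPacket_le p
  obtain ⟨n, hn⟩ := exists_nat_gt (2 * (C * E : ℝ))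
  have hbound : ENNReal.ofReal (√(n ^ 2 : ℕ) / 2) ≤ ENNReal.ofReal (C * E) :=
    calc ENNReal.ofReal (√(n ^ 2 : ℕ) / 2)
        ≤ mixedNormXY p ∞ (doubleRieszTransform _) :=
          sqrt_div_two_le_mixedNormXY_lacunaryPacket hp (n ^ 2)
      _ ≤ C * mixedNormYX ∞ p _ := hC _
      _ ≤ C * E := by gcongr; exact hE _
      _ = ENNReal.ofReal (C * E) := by simp [ENNReal.ofReal_mul]
  rw [ENNReal.ofReal_le_ofReal_iff (by positivity), Nat.cast_pow,
    Real.sqrt_sq (Nat.cast_nonneg n)] at hbound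
  linarith

theorem theorem2p5 (p : ℝ) (hp : 2 < p) :
    ¬ ∃ C : ℝ≥0, ∀ f : 𝓢(ℝ × ℝ, ℂ),
      mixedNormXY (ENNReal.ofReal p) ∞ (doubleRieszTransform f) ≤
        C * mixedNormYX ∞ (ENNReal.ofReal p) f :=
  theorem2p5_general _ (ENNReal.ofNat_le_ofReal.2 hp.le)
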